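/- Let $n = qd$ with integers $q, d$, let $p$ be a nonnegative integer and let $C \in \mathbb{R}^{n\times n}$ be symmetric. Write $\langle A, B\rangle = \operatorname{trace}(A^\top B)$. For $X\in\mathbb{R}^{n\times n}$ let $\mathrm{bd}(X)$ be the matrix obtained from $X$ by keeping the $q$ consecutive diagonal blocks of size $d\times d$ and setting all other entries to zero. The Orthogonal-Cut SDP is $$\min_{X = X^\top \in \mathbb{R}^{n\times n}} \langle C, X\rangle \quad\text{subject to}\quad \mathrm{bd}(X) = I_n,\ X \succeq 0,$$ and its Burer--Monteiro factorization is $$\min_{Y\in\mathbb{R}^{n\times p}} g(Y) = \langle CY, Y\rangle \quad\text{subject to}\quad Y \in \mathcal{M} = \{Y \in \mathbb{R}^{n\times p} : \mathrm{bd}(YY^\top) = I_n\}.$$ The tangent space of $\mathcal{M}$ at $Y$ is $T_Y = \{\dot Y \in \mathbb{R}^{n\times p} : \mathrm{bd}(\dot Y Y^\top + Y\dot Y^\top) = 0\}$; let $\mathrm{Proj}_Y$ be the orthogonal projector onto $T_Y$ for $\langle\cdot,\cdot\rangle$. The Riemannian gradient of $g$ is $\operatorname{grad} g(Y) = \mathrm{Proj}_Y(\nabla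 g(Y))$ and the Riemannian Hessian is $\operatorname{Hess} g(Y)[\dot Y] = \mathrm{Proj}_Y(\mathrm{D}\operatorname{grad} g(Y)[\dot Y])$ for $\dot Y\in T_Y$. A point $Y\in\mathcal{M}$ is a second-order critical point if $\operatorname{grad} g(Y) = 0$ and $\langle \dot Y, \operatorname{Hess} g(Y)[\dot Y]\rangle \ge 0$ for all $\dot Y\in T_Y$. If $p > \frac{d+1}{d+3}\,n$, then, for every symmetric $C$, every second-order critical point $Y$ of the factorized problem is globally optimal for it, and $X = YY^\top$ is globally optimal for the Orthogonal-Cut SDP. In particular, for the Max-Cut SDP (the case $d = 1$, in which the constraint $\mathrm{bd}(X) = I_n$ reads $\operatorname{diag}(X) = (1,\dots,1)^\top$, and $\mathrm{bd}$ is replaced by $\operatorname{diag}$ throughout) the same conclusion holds whenever $p > n/2$. -/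

import Mathlib

open scoped Matrix

/-! ### The Frobenius inner product on real matrices -/

attribute [local instance] Matrix.frobeniusNormedAddCommGroup Matrix.frobeniusNormedSpace

/-- The Euclidean inner product `⟨A, B⟩ = trace (Aᵀ B)` on real matrices; its norm is Mathlib's
Frobenius norm. -/
@[reducible]
noncomputable def frobeniusInnerProductSpace (m k : Type*) [Fintype m] [Fintype k] :
    InnerProductSpace ℝ (Matrix m k ℝ) where
  inner A B := (Aᵀ * B).trace
  norm_sq_eq_re_inner A := by
    rw [Matrix.frobenius_norm_def, ← Real.rpow_natCast, ← Real.rpow_mul (by positivity)]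
    simp only [Matrix.trace, Matrix.diag, Matrix.mul_apply, Matrix.transpose_apply]
    rw [Finset.sum_comm]
    simp [pow_two]
  conj_inner_symm A B := by
    rw [← Matrix.trace_transpose]
    simp
  add_left A B D := by simp [Matrix.add_mul]
  smul_left A B r := by simp

attribute [local instance] frobeniusInnerProductSpace

/-! ### Riemannian first- and second-order objects on a level set -/

section LevelSet

variable {E F : Type*} [NormedAddCommGroup E] [InnerProductSpace ℝ E] [FiniteDimensional ℝ E]
  [CompleteSpace E] [NormedAddCommGroup F] [NormedSpace ℝ F]

/-- The tangent space at `y` to the level set of `h` through `y`: the kernel of `D h(y)`. -/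
noncomputable def tangentSpaceAt (h : E → F) (y : E) : Submodule ℝ E :=
  LinearMap.ker (fderiv ℝ h y : E →ₗ[ℝ] F)

/-- The Riemannian gradient: the orthogonal projection of the Euclidean gradient of `g` onto the
tangent space. -/
noncomputable def riemannianGrad (h : E → F) (g : E → ℝ) (y : E) : E :=
  (tangentSpaceAt h y).starProjection (gradient g y)

/-- The Riemannian Hessian `v ↦ Proj_y (D grad g (y)[v])`: the orthogonal projection onto the tangent
space of the Fréchet derivative of the Riemannian gradient vector field. -/
noncomputable def riemannianHess (h : E → F) (g : E → ℝ) (y v : E) : E :=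
  (tangentSpaceAt h y).starProjection (fderiv ℝ (riemannianGrad h g) y v)

end LevelSet

/-! ### Semidefinite programs and their Burer–Monteiro factorizations -/

section SDP

variable {n p : ℕ} {V : Type*} [NormedAddCommGroup V] [NormedSpace ℝ V]

/-- The search space `{X : 𝒜(X) = b, X ⪰ 0}` of the SDP (`PosSemidef` includes symmetry). -/
def sdpFeasible (𝒜 : Matrix (Fin n) (Fin n) ℝ →ₗ[ℝ] V) (b : V) : Set (Matrix (Fin n) (Fin n) ℝ) :=
  {X | 𝒜 X = b ∧ X.PosSemidef}

/-- `X` is globally optimal for `min ⟨C, X⟩` subject to `𝒜(X) = b`, `X ⪰ 0`. -/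
def IsSDPOptimal (𝒜 : Matrix (Fin n) (Fin n) ℝ →ₗ[ℝ] V) (b : V) (C X : Matrix (Fin n) (Fin n) ℝ) :
    Prop :=
  X ∈ sdpFeasible 𝒜 b ∧ IsMinOn (fun X' => inner ℝ C X') (sdpFeasible 𝒜 b) X

/-- The map `Y ↦ 𝒜(Y Yᵀ)` defining the constraints of the factorized problem. -/
def bmConstraint (p : ℕ) (𝒜 : Matrix (Fin n) (Fin n) ℝ →ₗ[ℝ] V) (Y : Matrix (Fin n) (Fin p) ℝ) : V :=
  𝒜 (Y * Yᵀ)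

/-- The search space `ℳ = {Y ∈ ℝⁿˣᵖ : 𝒜(Y Yᵀ) = b}` of the factorized problem. -/
def bmFeasible (p : ℕ) (𝒜 : Matrix (Fin n) (Fin n) ℝ →ₗ[ℝ] V) (b : V) :
    Set (Matrix (Fin n) (Fin p) ℝ) :=
  {Y | bmConstraint p 𝒜 Y = b}

/-- The cost `g(Y) = ⟨C Y, Y⟩`. -/
noncomputable def bmCost (p : ℕ) (C : Matrix (Fin n) (Fin n) ℝ) (Y : Matrix (Fin n) (Fin p) ℝ) : ℝ :=
  inner ℝ (C * Y) Y

/-- `Y` is globally optimal for `min ⟨C Y, Y⟩` subject to `𝒜(Y Yᵀ) = b`. -/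
def IsBMOptimal (𝒜 : Matrix (Fin n) (Fin n) ℝ →ₗ[ℝ] V) (b : V) (C : Matrix (Fin n) (Fin n) ℝ)
    (Y : Matrix (Fin n) (Fin p) ℝ) : Prop :=
  Y ∈ bmFeasible p 𝒜 b ∧ IsMinOn (bmCost p C) (bmFeasible p 𝒜 b) Y

/-- `Y ∈ ℳ` is a second-order critical point: the Riemannian gradient of the cost vanishes at `Y` and
the Riemannian Hessian is positive semidefinite on the tangent space at `Y`. -/
def IsSecondOrderCritical (𝒜 : Matrix (Fin n) (Fin n) ℝ →ₗ[ℝ] V) (b : V)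
    (C : Matrix (Fin n) (Fin n) ℝ) (Y : Matrix (Fin n) (Fin p) ℝ) : Prop :=
  Y ∈ bmFeasible p 𝒜 b ∧
  riemannianGrad (bmConstraint p 𝒜) (bmCost p C) Y = 0 ∧
  ∀ Ydot ∈ tangentSpaceAt (bmConstraint p 𝒜) Y,
    0 ≤ inner ℝ Ydot (riemannianHess (bmConstraint p 𝒜) (bmCost p C) Y Ydot)

end SDP

/-! ### The Orthogonal-Cut and Max-Cut constraints -/

/-- The operator that keeps the consecutive diagonal blocks of size `d × d` and zeros out all other
entries: with 0-based indices, row `i` lies in block `i / d`. -/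
def blockDiagPart (n d : ℕ) : Matrix (Fin n) (Fin n) ℝ →ₗ[ℝ] Matrix (Fin n) (Fin n) ℝ where
  toFun X := Matrix.of fun i j => if (i : ℕ) / d = (j : ℕ) / d then X i j else 0
  map_add' X X' := by
    ext i j
    by_cases h : (i : ℕ) / d = (j : ℕ) / d <;> simp [h]
  map_smul' r X := by
    ext i j
    by_cases h : (i : ℕ) / d = (j : ℕ) / d <;> simp [h]

/-! Let P be the orthogonal projection `symBlock` onto N, the symmetric block-diagonal matrices.
Criticality of `Y` gives a multiplier `M` such that the slack S = 2C - P(M) satisfies SY = 0 and ⟨v,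
Sv⟩ ≥ 0 for tangent v (`IsSecondOrderCritical.exists_multiplier`). If S ⪰ 0, weak duality finishes:
on the feasible set 2⟨C, X⟩ is ⟨S, X⟩ plus a constant, and ⟨S, YYᵀ⟩ = 0.

So it must be shown that uᵀSu ≥ 0 for each u. It is enough to find z ≠ 0 and B with v = uzᵀ - YB
tangent: since SY = 0, ⟨v, Sv⟩ = (uᵀSu)|z|². If Yz = 0 for some z ≠ 0, take B = 0. Otherwise `Y` has
full column rank, and by duality B exists exactly when the functional Λ ↦ ⟨uzᵀYᵀ, Λ⟩ on N vanishes
on the kernel of F : Λ ↦ YᵀΛY. This imposes dim ker F linear conditions on z ∈ ℝᵖ, so dim ker F < p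
suffices.

Now dim N ≤ n(d+1)/2, and the key bound is rank F ≥ p(d+1)/2. Hence dim ker F ≤ (n-p)(d+1)/2, which
is below p exactly when (d+1)n < (d+3)p. For the key bound, the range of F contains the symmetric
squares of the row spaces of the q blocks of `Y`; these spaces have dimension d and together span
ℝᵖ. When one of them adds e new dimensions to the span, its symmetric square adds at least d + (d-1)
+ ... + (d-e+1) ≥ e(d+1)/2 (`two_mul_finrank_le_finrank_sup_symSquare`). -/

/-! ### Dimension of sums of symmetric squares of subspaces -/

section SymSquare

open Module

variable {κ : Type*}

/-- The symmetrized product `x yᵀ + y xᵀ`, as a linear map in `y`. -/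
noncomputable def symProd (x : κ → ℝ) : (κ → ℝ) →ₗ[ℝ] Matrix κ κ ℝ where
  toFun y := Matrix.vecMulVec x y + Matrix.vecMulVec y x
  map_add' y z := by
    ext i j
    simp [Matrix.vecMulVec_apply]
    ring
  map_smul' r y := by
    ext i j
    simp [Matrix.vecMulVec_apply]
    ring

theorem symProd_apply (x y : κ → ℝ) (i j : κ) : symProd x y i j = x i * y j + y i * x j := rfl

theorem symProd_row (x y : κ → ℝ) (i : κ) : symProd x y i = x i • y + y i • x := rfl

theorem symProd_comm (x y : κ → ℝ) : symProd x y = symProd y x := by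
  ext i j
  rw [symProd_apply, symProd_apply]
  ring

/-- The space of symmetric matrices spanned by the products `x yᵀ + y xᵀ` with `x, y ∈ L`. -/
noncomputable def symSquare (L : Submodule ℝ (κ → ℝ)) : Submodule ℝ (Matrix κ κ ℝ) :=
  Submodule.span ℝ {M | ∃ x ∈ L, ∃ y ∈ L, M = symProd x y}

theorem symProd_mem_symSquare {L : Submodule ℝ (κ → ℝ)} {x y : κ → ℝ} (hx : x ∈ L) (hy : y ∈ L) :
    symProd x y ∈ symSquare L :=
  Submodule.subset_span ⟨x, hx, y, hy, rfl⟩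

theorem symSquare_mono {L L' : Submodule ℝ (κ → ℝ)} (h : L ≤ L') : symSquare L ≤ symSquare L' :=
  Submodule.span_mono fun _ ⟨x, hx, y, hy, hM⟩ => ⟨x, h hx, y, h hy, hM⟩

theorem dual_row_eq_zero_of_mem_symSquare {L : Submodule ℝ (κ → ℝ)} {φ : Dual ℝ (κ → ℝ)}
    (h : L ≤ LinearMap.ker φ) {M : Matrix κ κ ℝ} (hM : M ∈ symSquare L) (i : κ) : φ (M i) = 0 := by
  induction hM using Submodule.span_induction with
  | mem M hM =>
    obtain ⟨x, hx, y, hy, rfl⟩ := hM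
    have h1 : φ x = 0 := h hx
    have h2 : φ y = 0 := h hy
    rw [symProd_row]
    simp [h1, h2]
  | zero => exact map_zero φ
  | add A B _ _ hA hB => rw [show (A + B) i = A i + B i from rfl, map_add, hA, hB, add_zero]
  | smul r A _ hA => rw [show (r • A) i = r • A i from rfl, map_smul, hA, smul_zero]

theorem symSquare_span_le {s : Set (κ → ℝ)} {R : Submodule ℝ (Matrix κ κ ℝ)}
    (h : ∀ x ∈ s, ∀ y ∈ s, symProd x y ∈ R) : symSquare (Submodule.span ℝ s) ≤ R := by
  refine Submodule.span_le.2 ?_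
  rintro _ ⟨x, hx, y, hy, rfl⟩
  have key : ∀ x ∈ s, ∀ y ∈ Submodule.span ℝ s, symProd x y ∈ R := fun x hx y hy =>
    (Submodule.span_le (p := R.comap (symProd x))).2 (fun y hy => h x hx y hy) hy
  have : x ∈ R.comap (symProd y) :=
    (Submodule.span_le (p := R.comap (symProd y))).2
      (fun x hx => by
        rw [SetLike.mem_coe, Submodule.mem_comap, symProd_comm]
        exact key x hx y hy) hx
  rw [SetLike.mem_coe, symProd_comm]
  exact this

theorem finrank_inf_ker_add_one {V : Type*} [AddCommGroup V] [Module ℝ V] [FiniteDimensional ℝ V]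
    (L : Submodule ℝ V) (φ : Dual ℝ V) {f : V} (hf : f ∈ L) (hφ : φ f ≠ 0) :
    finrank ℝ (L ⊓ LinearMap.ker φ : Submodule ℝ V) + 1 = finrank ℝ L := by
  have hne : φ.domRestrict L ≠ 0 := fun h => hφ (by simpa using LinearMap.congr_fun h ⟨f, hf⟩)
  rw [← Module.Dual.finrank_ker_add_one_of_ne_zero (f := φ.domRestrict L) hne,
    ← Submodule.map_comap_subtype, Submodule.finrank_map_subtype_eq]
  rfl

variable [Fintype κ]

/-- Contracting with `φ` shows that the products `f yᵀ + y fᵀ`, `y ∈ L`, are independent modulo a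
space of matrices whose rows are killed by `φ`. -/
theorem finrank_add_le_finrank_sup_symSquare {T : Submodule ℝ (Matrix κ κ ℝ)}
    {L : Submodule ℝ (κ → ℝ)} {φ : Dual ℝ (κ → ℝ)} (hT : ∀ M ∈ T, ∀ i, φ (M i) = 0)
    {f : κ → ℝ} (hf : f ∈ L) (hφ : φ f ≠ 0) :
    finrank ℝ T + finrank ℝ L ≤ finrank ℝ (T ⊔ symSquare L : Submodule ℝ (Matrix κ κ ℝ)) := by
  have key : ∀ y, (∀ i, φ (symProd f y i) = 0) → y = 0 := by
    intro y hy
    have h1 : ∀ i, f i * φ y + y i * φ f = 0 := fun i => by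
      simpa [symProd_row] using hy i
    have h2 : φ y • f + φ f • y = 0 := by
      ext i
      simp only [Pi.add_apply, Pi.smul_apply, smul_eq_mul, Pi.zero_apply]
      linarith [h1 i]
    have h3 := congrArg φ h2
    simp only [map_add, map_smul, smul_eq_mul, map_zero] at h3
    have h4 : φ y = 0 := by
      have : φ f * φ y = 0 := by linarith
      exact (mul_eq_zero.1 this).resolve_left hφ
    rw [h4, zero_smul, zero_add] at h2
    exact (smul_eq_zero.1 h2).resolve_left hφ
  have hinj : Function.Injective ((symProd f).domRestrict L) := by
    rw [← LinearMap.ker_eq_bot, LinearMap.ker_eq_bot']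
    intro y hy
    refine Subtype.ext (key y fun i => ?_)
    have : symProd f (y : κ → ℝ) = 0 := hy
    rw [this]
    exact map_zero φ
  set R := LinearMap.range ((symProd f).domRestrict L)
  have hRL : R ≤ symSquare L := by
    rintro _ ⟨y, rfl⟩
    exact symProd_mem_symSquare hf y.2
  have hdisj : T ⊓ R = ⊥ := by
    rw [eq_bot_iff]
    rintro M ⟨hM, ⟨y, rfl⟩⟩
    have : (y : κ → ℝ) = 0 := key y fun i => hT _ hM i
    simp [this]
  have h := Submodule.finrank_sup_add_finrank_inf_eq T R
  rw [hdisj, finrank_bot, LinearMap.finrank_range_of_inj hinj] at h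
  rw [← h, add_zero]
  exact Submodule.finrank_mono (sup_le_sup_left hRL T)

/-- The gain over T is at least ℓ + (ℓ-1) + ... + (ℓ-e+1) with ℓ = dim L, doubled here and with e²
moved across to avoid subtraction in ℕ. Each step of the induction cuts L by a functional that kills
W but not L, and the dimensions thus lost are recovered from the products f yᵀ + y fᵀ. -/
theorem two_mul_finrank_le_finrank_sup_symSquare (e : ℕ) {W : Submodule ℝ (κ → ℝ)}
    {T : Submodule ℝ (Matrix κ κ ℝ)}
    (hT : ∀ φ : Dual ℝ (κ → ℝ), W ≤ LinearMap.ker φ → ∀ M ∈ T, ∀ i, φ (M i) = 0)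
    (L : Submodule ℝ (κ → ℝ))
    (he : finrank ℝ (L ⊔ W : Submodule ℝ (κ → ℝ)) = finrank ℝ W + e) :
    2 * finrank ℝ T + e * (2 * finrank ℝ L + 1) ≤
      2 * finrank ℝ (T ⊔ symSquare L : Submodule ℝ (Matrix κ κ ℝ)) + e * e := by
  induction e generalizing L with
  | zero =>
    have := Submodule.finrank_mono (le_sup_left : T ≤ T ⊔ symSquare L)
    lia
  | succ e ih =>
    have hLW : ¬ L ≤ W := fun h => by
      rw [sup_eq_right.2 h] at he
      lia
    obtain ⟨f, hf, hfW⟩ := SetLike.not_le_iff_exists.1 hLW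
    obtain ⟨φ, hφ, hW⟩ := Submodule.exists_le_ker_of_notMem hfW
    have h1 := finrank_inf_ker_add_one L φ hf hφ
    have h2 := finrank_inf_ker_add_one (L ⊔ W) φ (Submodule.mem_sup_left hf) hφ
    have h3 : (L ⊔ W) ⊓ LinearMap.ker φ = (L ⊓ LinearMap.ker φ) ⊔ W := by
      rw [sup_comm, sup_inf_assoc_of_le L hW, sup_comm]
    rw [h3] at h2
    have h4 := ih (L ⊓ LinearMap.ker φ) (by lia)
    have h5 := finrank_add_le_finrank_sup_symSquare
      (T := T ⊔ symSquare (L ⊓ LinearMap.ker φ)) (L := L) (φ := φ) (fun M hM i => by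
        obtain ⟨A, hA, B, hB, rfl⟩ := Submodule.mem_sup.1 hM
        rw [show (A + B) i = A i + B i from rfl, map_add, hT φ hW A hA i,
          dual_row_eq_zero_of_mem_symSquare inf_le_right hB i, add_zero]) hf hφ
    rw [sup_assoc, sup_eq_right.2 (symSquare_mono (inf_le_left : L ⊓ LinearMap.ker φ ≤ L))] at h5
    rw [← h1] at h5 ⊢
    nlinarith

theorem mul_finrank_sup_le_two_mul_finrank_sup_symSquare {β : Type*} (s : Finset β)
    (L : β → Submodule ℝ (κ → ℝ)) {d : ℕ} (hL : ∀ b, finrank ℝ (L b) = d) :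
    (d + 1) * finrank ℝ (s.sup L : Submodule ℝ (κ → ℝ)) ≤
      2 * finrank ℝ (s.sup fun b => symSquare (L b) : Submodule ℝ (Matrix κ κ ℝ)) := by
  classical
  induction s using Finset.induction_on with
  | empty => rw [Finset.sup_empty, finrank_bot, mul_zero]; exact Nat.zero_le _
  | insert b s hb ih =>
    rw [Finset.sup_insert, Finset.sup_insert]
    have hle : finrank ℝ (s.sup L : Submodule ℝ (κ → ℝ)) ≤
        finrank ℝ (L b ⊔ s.sup L : Submodule ℝ (κ → ℝ)) := Submodule.finrank_mono le_sup_right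
    obtain ⟨e, he⟩ := Nat.exists_eq_add_of_le hle
    have hT : ∀ φ : Dual ℝ (κ → ℝ), s.sup L ≤ LinearMap.ker φ →
        ∀ M ∈ s.sup (fun b => symSquare (L b)), ∀ i, φ (M i) = 0 := by
      intro φ hφ M hM i
      refine dual_row_eq_zero_of_mem_symSquare hφ ?_ i
      have : s.sup (fun b => symSquare (L b)) ≤ symSquare (s.sup L) :=
        Finset.sup_le fun c hc => symSquare_mono (Finset.le_sup hc)
      exact this hM
    have h := two_mul_finrank_le_finrank_sup_symSquare e hT (L b) he
    have h2 := Submodule.finrank_add_le_finrank_add_finrank (L b) (s.sup L)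
    rw [he, hL] at h2
    rw [hL] at h
    rw [he, sup_comm (symSquare (L b))]
    have h3 : e ≤ d := by lia
    -- With e ≤ d, the gain e(2d+1) - e² is at least e(d+1), which is linear in e and so adds up
    -- over the subspaces.
    have h4 : e * e ≤ e * d := Nat.mul_le_mul_left e h3
    nlinarith

end SymSquare

/-! ### The Frobenius inner product and the symmetric block-diagonal part -/

section SymBlock

theorem matrix_inner_eq_trace {m k : Type*} [Fintype m] [Fintype k] (A B : Matrix m k ℝ) :
    inner ℝ A B = (Aᵀ * B).trace := rfl

theorem matrix_inner_eq_sum {m k : Type*} [Fintype m] [Fintype k] (A B : Matrix m k ℝ) :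
    inner ℝ A B = ∑ i, ∑ j, A i j * B i j := by
  rw [matrix_inner_eq_trace, Finset.sum_comm]
  rfl

theorem matrix_inner_mul_left {m k l : Type*} [Fintype m] [Fintype k] [Fintype l]
    (A : Matrix m l ℝ) (B : Matrix l k ℝ) (D : Matrix m k ℝ) :
    inner ℝ (A * B) D = inner ℝ A (D * Bᵀ) := by
  rw [matrix_inner_eq_trace, matrix_inner_eq_trace, Matrix.transpose_mul, Matrix.mul_assoc,
    Matrix.trace_mul_comm, Matrix.mul_assoc]

theorem matrix_inner_mul_right {m k l : Type*} [Fintype m] [Fintype k] [Fintype l]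
    (A : Matrix m l ℝ) (B : Matrix l k ℝ) (D : Matrix m k ℝ) :
    inner ℝ (A * B) D = inner ℝ B (Aᵀ * D) := by
  rw [matrix_inner_eq_trace, matrix_inner_eq_trace, Matrix.transpose_mul, Matrix.mul_assoc]

variable {n d : ℕ}

theorem blockDiagPart_apply (X : Matrix (Fin n) (Fin n) ℝ) (i j : Fin n) :
    blockDiagPart n d X i j = if (i : ℕ) / d = (j : ℕ) / d then X i j else 0 := rfl

/-- The symmetric part of the block-diagonal part of a matrix. -/
noncomputable def symBlock (n d : ℕ) : Matrix (Fin n) (Fin n) ℝ →ₗ[ℝ] Matrix (Fin n) (Fin n) ℝ where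
  toFun X := (1 / 2 : ℝ) • blockDiagPart n d (X + Xᵀ)
  map_add' X X' := by
    rw [← smul_add, ← map_add, Matrix.transpose_add]
    congr 2
    abel
  map_smul' r X := by
    rw [Matrix.transpose_smul, ← smul_add, map_smul, RingHom.id_apply, smul_comm]

theorem symBlock_eq (X : Matrix (Fin n) (Fin n) ℝ) :
    symBlock n d X = (1 / 2 : ℝ) • blockDiagPart n d (X + Xᵀ) := rfl

theorem symBlock_apply (X : Matrix (Fin n) (Fin n) ℝ) (i j : Fin n) :
    symBlock n d X i j = if (i : ℕ) / d = (j : ℕ) / d then (X i j + X j i) / 2 else 0 := by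
  rw [symBlock_eq, Matrix.smul_apply, blockDiagPart_apply]
  split_ifs
  · simp only [Matrix.add_apply, Matrix.transpose_apply, smul_eq_mul]
    ring
  · simp

theorem symBlock_transpose (X : Matrix (Fin n) (Fin n) ℝ) :
    (symBlock n d X)ᵀ = symBlock n d X := by
  ext i j
  simp only [Matrix.transpose_apply, symBlock_apply, eq_comm (a := (j : ℕ) / d), add_comm (X j i)]

theorem symBlock_symBlock (X : Matrix (Fin n) (Fin n) ℝ) :
    symBlock n d (symBlock n d X) = symBlock n d X := by
  ext i j
  rw [symBlock_apply, symBlock_apply, symBlock_apply]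
  by_cases h : (i : ℕ) / d = (j : ℕ) / d
  · rw [if_pos h, if_pos h, if_pos h.symm]
    ring
  · rw [if_neg h, if_neg h]

/-- Self-adjointness, together with idempotence, makes `symBlock` an orthogonal projection. -/
theorem inner_symBlock_left (A B : Matrix (Fin n) (Fin n) ℝ) :
    inner ℝ (symBlock n d A) B = inner ℝ A (symBlock n d B) := by
  have expand : ∀ A B : Matrix (Fin n) (Fin n) ℝ, inner ℝ (symBlock n d A) B =
      (∑ i : Fin n, ∑ j : Fin n, if (i : ℕ) / d = (j : ℕ) / d then A i j * B i j / 2 else 0) +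
      ∑ i : Fin n, ∑ j : Fin n, if (i : ℕ) / d = (j : ℕ) / d then A j i * B i j / 2 else 0 := by
    intro A B
    rw [matrix_inner_eq_sum, ← Finset.sum_add_distrib]
    refine Finset.sum_congr rfl fun i _ => ?_
    rw [← Finset.sum_add_distrib]
    refine Finset.sum_congr rfl fun j _ => ?_
    rw [symBlock_apply]
    split_ifs <;> ring
  rw [real_inner_comm, real_inner_comm (symBlock n d A), real_inner_comm (symBlock n d B),
    expand, expand]
  congr 1
  · simp only [mul_comm]
  · rw [Finset.sum_comm]
    simp only [mul_comm, eq_comm]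

theorem finProdFinEquiv_div {q d : ℕ} (b : Fin q) (k : Fin d) :
    ((finProdFinEquiv (b, k) : Fin (q * d)) : ℕ) / d = b := by
  rw [show ((finProdFinEquiv (b, k) : Fin (q * d)) : ℕ) = k + d * b from rfl,
    Nat.add_mul_div_left _ _ k.pos, Nat.div_eq_of_lt k.2, zero_add]

/-- Symmetric block-diagonal matrices are determined by the lower triangles of their blocks. -/
theorem two_mul_finrank_range_symBlock_le (q d : ℕ) :
    2 * Module.finrank ℝ (LinearMap.range (symBlock (q * d) d)) ≤ q * d * (d + 1) := by
  let e : Fin q × Fin d ≃ Fin (q * d) := finProdFinEquiv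
  let ι := Fin q × (Σ l : Fin d, Fin (l + 1))
  let f : LinearMap.range (symBlock (q * d) d) →ₗ[ℝ] (ι → ℝ) :=
    { toFun := fun M x => (M : Matrix (Fin (q * d)) (Fin (q * d)) ℝ) (e (x.1, x.2.1))
        (e (x.1, ⟨x.2.2, by lia⟩))
      map_add' := fun _ _ => rfl
      map_smul' := fun _ _ => rfl }
  have hdiv : ∀ b k, ((e (b, k) : Fin (q * d)) : ℕ) / d = b := finProdFinEquiv_div
  have hf : Function.Injective f := by
    rw [← LinearMap.ker_eq_bot, LinearMap.ker_eq_bot']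
    rintro ⟨M, A, rfl⟩ hM
    have hlow : ∀ b k l, k ≤ l → symBlock (q * d) d A (e (b, l)) (e (b, k)) = 0 := by
      intro b k l hkl
      exact congrFun hM (b, ⟨l, ⟨k, by lia⟩⟩)
    refine Subtype.ext ?_
    ext i j
    obtain ⟨⟨b, k⟩, rfl⟩ := e.surjective i
    obtain ⟨⟨c, l⟩, rfl⟩ := e.surjective j
    change symBlock (q * d) d A (e (b, k)) (e (c, l)) = 0
    by_cases hbc : b = c
    · subst hbc
      rcases le_total l k with h | h
      · exact hlow b l k h
      · rw [← symBlock_transpose, Matrix.transpose_apply]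
        exact hlow b k l h
    · rw [symBlock_apply, hdiv, hdiv, if_neg fun h => hbc (Fin.ext h)]
  have h1 := LinearMap.finrank_le_finrank_of_injective hf
  have h2 : Fintype.card ι = q * ∑ l ∈ Finset.range d, (l + 1) := by
    simp [ι, Finset.sum_range]
  have h3 : (∑ l ∈ Finset.range d, (l + 1)) * 2 = d * (d + 1) := by
    have := Finset.sum_range_id_mul_two (d + 1)
    rw [Finset.sum_range_succ'] at this
    simp only [add_zero, Nat.add_sub_cancel] at this
    rw [this, mul_comm]
  rw [Module.finrank_fintype_fun_eq_card, h2] at h1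
  calc _ ≤ 2 * (q * ∑ l ∈ Finset.range d, (l + 1)) := Nat.mul_le_mul_left 2 h1
    _ = q * ((∑ l ∈ Finset.range d, (l + 1)) * 2) := by ring
    _ = q * d * (d + 1) := by rw [h3, mul_assoc]

end SymBlock

/-! ### Tangent directions at a point of full column rank -/

section FullRank

open Module

/-- The linear map `Λ ↦ Yᵀ Λ Y` on symmetric block-diagonal matrices. -/
noncomputable def symBlockCongr {n p : ℕ} (d : ℕ) (Y : Matrix (Fin n) (Fin p) ℝ) :
    LinearMap.range (symBlock n d) →ₗ[ℝ] Matrix (Fin p) (Fin p) ℝ where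
  toFun Λ := Yᵀ * (Λ : Matrix (Fin n) (Fin n) ℝ) * Y
  map_add' Λ Λ' := by simp [Matrix.mul_add, Matrix.add_mul]
  map_smul' r Λ := by simp

/-- The rows of each block of `Y` are orthonormal, so they span a space of dimension d. For rows x,
y of one block, xyᵀ + yxᵀ is YᵀΛY with Λ the symmetrized matrix unit at their positions. -/
theorem mul_le_two_mul_finrank_range_symBlockCongr {q d p : ℕ} {Y : Matrix (Fin (q * d)) (Fin p) ℝ}
    (hY : blockDiagPart (q * d) d (Y * Yᵀ) = 1) (hinj : ∀ z, Y *ᵥ z = 0 → z = 0) :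
    (d + 1) * p ≤ 2 * finrank ℝ (LinearMap.range (symBlockCongr d Y)) := by
  let e : Fin q × Fin d ≃ Fin (q * d) := finProdFinEquiv
  have hdiv : ∀ b k, ((e (b, k) : Fin (q * d)) : ℕ) / d = b := finProdFinEquiv_div
  let L : Fin q → Submodule ℝ (Fin p → ℝ) := fun b =>
    Submodule.span ℝ (Set.range fun k => Y (e (b, k)))
  have hdot : ∀ b k l, Y (e (b, k)) ⬝ᵥ Y (e (b, l)) = if k = l then 1 else 0 := by
    intro b k l
    have h := congrFun (congrFun hY (e (b, k))) (e (b, l))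
    rw [blockDiagPart_apply, if_pos (by rw [hdiv, hdiv]), Matrix.one_apply] at h
    simpa [Matrix.mul_apply, dotProduct] using h
  have hL : ∀ b, finrank ℝ (L b) = d := by
    intro b
    have hli : LinearIndependent ℝ fun k => Y (e (b, k)) := by
      rw [Fintype.linearIndependent_iff]
      intro c hc k
      have h := congrArg (fun x => x ⬝ᵥ Y (e (b, k))) hc
      simpa [sum_dotProduct, hdot] using h
    rw [finrank_span_eq_card hli, Fintype.card_fin]
  -- A functional killing every row of `Y` is represented by a vector z with Yz = 0.
  have htop : Finset.univ.sup L = ⊤ := by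
    by_contra hne
    obtain ⟨x, -, hx⟩ := SetLike.exists_of_lt (lt_top_iff_ne_top.2 hne)
    obtain ⟨φ, hφ, hker⟩ := Submodule.exists_le_ker_of_notMem hx
    refine hφ ?_
    have hφz : ∀ x, φ x = x ⬝ᵥ fun i => φ (Pi.single i 1) := by
      intro x
      conv_lhs => rw [pi_eq_sum_univ' x]
      simp only [map_sum, map_smul, dotProduct, smul_eq_mul]
    have hz : (fun i => φ (Pi.single i 1)) = (0 : Fin p → ℝ) := by
      refine hinj _ ?_
      ext i
      obtain ⟨⟨b, k⟩, rfl⟩ := e.surjective i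
      rw [Matrix.mulVec, ← hφz]
      exact hker (Finset.le_sup (f := L) (Finset.mem_univ b) (Submodule.subset_span ⟨k, rfl⟩))
    rw [hφz, hz, dotProduct_zero]
  have hmain := mul_finrank_sup_le_two_mul_finrank_sup_symSquare Finset.univ L hL
  rw [htop, finrank_top, Module.finrank_fin_fun] at hmain
  refine hmain.trans (Nat.mul_le_mul_left 2 (Submodule.finrank_mono (Finset.sup_le fun b _ => ?_)))
  refine symSquare_span_le ?_
  rintro _ ⟨k, rfl⟩ _ ⟨l, rfl⟩
  -- The entry 2 offsets the factor 1/2 in `symBlock`.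
  let A : Matrix (Fin (q * d)) (Fin (q * d)) ℝ := Matrix.single (e (b, k)) (e (b, l)) 2
  refine ⟨⟨symBlock (q * d) d A, A, rfl⟩, ?_⟩
  have hA : symBlock (q * d) d A =
      Matrix.single (e (b, k)) (e (b, l)) 1 + Matrix.single (e (b, l)) (e (b, k)) 1 := by
    have hA' : blockDiagPart (q * d) d (A + Aᵀ) = A + Aᵀ := by
      ext i j
      rw [blockDiagPart_apply]
      split_ifs with h
      · rfl
      · have h5 : A i j = 0 := Matrix.single_apply_of_ne _ _ _ _ _ (by
          rintro ⟨rfl, rfl⟩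
          exact h (by rw [hdiv, hdiv]))
        have h6 : A j i = 0 := Matrix.single_apply_of_ne _ _ _ _ _ (by
          rintro ⟨rfl, rfl⟩
          exact h (by rw [hdiv, hdiv]))
        rw [Matrix.add_apply, Matrix.transpose_apply, h5, h6, add_zero]
    rw [symBlock_eq, hA', Matrix.transpose_single, smul_add, Matrix.smul_single, Matrix.smul_single]
    norm_num
  change Yᵀ * symBlock (q * d) d A * Y = _
  rw [hA, Matrix.mul_add, Matrix.add_mul]
  ext i j
  rw [symProd_apply]
  simp [Matrix.mul_apply, Matrix.single_apply, ite_and, mul_comm]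

theorem exists_symBlock_vecMulVec_eq {n q d p : ℕ} (hn : n = q * d)
    (hp : (d + 1) * n < (d + 3) * p) {Y : Matrix (Fin n) (Fin p) ℝ}
    (hY : blockDiagPart n d (Y * Yᵀ) = 1) (hinj : ∀ z, Y *ᵥ z = 0 → z = 0) (u : Fin n → ℝ) :
    ∃ z : Fin p → ℝ, z ≠ 0 ∧ ∃ B : Matrix (Fin p) (Fin p) ℝ,
      symBlock n d (Matrix.vecMulVec u z * Yᵀ) = symBlock n d (Y * B * Yᵀ) := by
  subst hn
  set N := LinearMap.range (symBlock (q * d) d)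
  set F := symBlockCongr d Y
  have h1 := mul_le_two_mul_finrank_range_symBlockCongr hY hinj
  have h2 := two_mul_finrank_range_symBlock_le q d
  have h3 := LinearMap.finrank_range_add_finrank_ker F
  have hK : finrank ℝ (LinearMap.ker F) < p := by
    change 2 * finrank ℝ N ≤ _ at h2
    nlinarith
  let ℓ : (Fin p → ℝ) →ₗ[ℝ] Dual ℝ N := LinearMap.mk₂ ℝ
    (fun z Λ => inner ℝ (Matrix.vecMulVec u z * Yᵀ) (Λ : Matrix (Fin (q * d)) (Fin (q * d)) ℝ))
    (fun z z' Λ => by rw [Matrix.vecMulVec_add, Matrix.add_mul, inner_add_left])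
    (fun r z Λ => by
      rw [Matrix.vecMulVec_smul, Matrix.smul_mul, real_inner_smul_left, smul_eq_mul])
    (fun z Λ Λ' => by rw [Submodule.coe_add, inner_add_right])
    (fun r z Λ => by rw [Submodule.coe_smul, real_inner_smul_right, smul_eq_mul])
  let ℓK : (Fin p → ℝ) →ₗ[ℝ] Dual ℝ (LinearMap.ker F) := (LinearMap.ker F).subtype.dualMap ∘ₗ ℓ
  have hne : LinearMap.ker ℓK ≠ ⊥ := by
    apply LinearMap.ker_ne_bot_of_finrank_lt
    rw [Module.finrank_fin_fun]
    exact (Subspace.dual_finrank_eq (K := ℝ) (V := LinearMap.ker F)).trans_lt hK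
  obtain ⟨z, hz, hz0⟩ := Submodule.exists_mem_ne_zero_of_ne_bot hne
  refine ⟨z, hz0, ?_⟩
  -- Fredholm alternative: a functional on N factors through F once it vanishes on ker F. The factor
  -- G is then represented by a matrix B.
  have hmem : ℓ z ∈ LinearMap.range F.dualMap := by
    rw [LinearMap.range_dualMap_eq_dualAnnihilator_ker, Submodule.mem_dualAnnihilator]
    intro Λ hΛ
    exact LinearMap.congr_fun hz ⟨Λ, hΛ⟩
  obtain ⟨G, hG⟩ := hmem
  let B : Matrix (Fin p) (Fin p) ℝ := Matrix.of fun i j => G (Matrix.single i j 1)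
  have hGB : ∀ M, G M = inner ℝ B M := by
    intro M
    rw [matrix_inner_eq_sum]
    conv_lhs => rw [Matrix.matrix_eq_sum_single M]
    simp only [map_sum]
    refine Finset.sum_congr rfl fun i _ => Finset.sum_congr rfl fun j _ => ?_
    rw [show Matrix.single i j (M i j) = M i j • Matrix.single i j (1 : ℝ) by simp, map_smul,
      smul_eq_mul, mul_comm]
    rfl
  refine ⟨B, ?_⟩
  rw [← sub_eq_zero, ← map_sub]
  set D := Matrix.vecMulVec u z * Yᵀ - Y * B * Yᵀ with hD
  -- Testing the factorization on Λ = P(D) gives ⟨D, P(D)⟩ = |P(D)|² = 0.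
  have hperp : inner ℝ D (symBlock (q * d) d D) = 0 := by
    have h4 : G (F ⟨symBlock (q * d) d D, D, rfl⟩) =
        inner ℝ (Matrix.vecMulVec u z * Yᵀ) (symBlock (q * d) d D) :=
      LinearMap.congr_fun hG ⟨symBlock (q * d) d D, D, rfl⟩
    rw [hGB] at h4
    rw [hD, inner_sub_left, ← hD, ← h4, matrix_inner_mul_left, matrix_inner_mul_right,
      Matrix.transpose_transpose, ← Matrix.mul_assoc, sub_eq_zero]
    rfl
  rw [← symBlock_symBlock, ← inner_symBlock_left] at hperp
  exact inner_self_eq_zero.1 hperp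

end FullRank

/-! ### Second-order conditions on a level set of a quadratic map -/

section LevelSetCalculus

variable {E F N : Type*} [NormedAddCommGroup E] [InnerProductSpace ℝ E]
  [NormedAddCommGroup F] [NormedSpace ℝ F]
  [NormedAddCommGroup N] [NormedSpace ℝ N] [FiniteDimensional ℝ N]

/-- The Gram operator `Λ ↦ D_y (R Λ y)` of the constraints at `y`, completed by the identity on the
kernel of the projection `P`. -/
noncomputable def gramOperator (D : E →ₗ[ℝ] E →ₗ[ℝ] N) (R : N →ₗ[ℝ] E →ₗ[ℝ] E) (P : N →ₗ[ℝ] N)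
    (y : E) : N →L[ℝ] N :=
  LinearMap.toContinuousLinearMap (D y ∘ₗ R.flip y + (LinearMap.id - P))

theorem gramOperator_apply (D : E →ₗ[ℝ] E →ₗ[ℝ] N) (R : N →ₗ[ℝ] E →ₗ[ℝ] E) (P : N →ₗ[ℝ] N)
    (y : E) (Λ : N) : gramOperator D R P y Λ = D y (R Λ y) + (Λ - P Λ) := rfl

variable [FiniteDimensional ℝ E]

theorem mem_tangentSpaceAt_of_quadratic {h : E → F} (b : E →ₗ[ℝ] E →ₗ[ℝ] F)
    (hb : ∀ y, h y = b y y) (y v : E) : v ∈ tangentSpaceAt h y ↔ b y v + b v y = 0 := by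
  have h' : HasFDerivAt (fun y => b y y) _ y :=
    b.toContinuousBilinearMap.hasFDerivAt_of_bilinear (hasFDerivAt_id y) (hasFDerivAt_id y)
  rw [tangentSpaceAt, funext hb, h'.fderiv]
  rfl

theorem gradient_inner_self [CompleteSpace E] {g : E → ℝ} (T : E →ₗ[ℝ] E)
    (hT : ∀ x y, inner ℝ (T x) y = inner ℝ x (T y)) (hg : ∀ y, g y = inner ℝ (T y) y) (y : E) :
    gradient g y = (2 : ℝ) • T y := by
  refine HasGradientAt.gradient ?_
  rw [hasGradientAt_iff_hasFDerivAt, funext hg]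
  have h : HasFDerivAt (fun y => inner ℝ (T y) y) _ y :=
    ((LinearMap.toContinuousLinearMap T).hasFDerivAt (x := y)).inner ℝ (hasFDerivAt_id y)
  refine h.congr_fderiv ?_
  ext v
  change inner ℝ (T y) v + inner ℝ (T v) y = inner ℝ ((2 : ℝ) • T y) v
  rw [hT v, real_inner_smul_left, real_inner_comm (T y) v]
  ring

theorem contDiff_gramOperator (D : E →ₗ[ℝ] E →ₗ[ℝ] N) (R : N →ₗ[ℝ] E →ₗ[ℝ] E) (P : N →ₗ[ℝ] N)
    {r : WithTop ℕ∞} : ContDiff ℝ r (gramOperator D R P) := by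
  rw [contDiff_clm_apply_iff]
  intro Λ
  simp only [gramOperator_apply]
  exact (D.toContinuousBilinearMap.isBoundedBilinearMap.contDiff.comp (contDiff_id.prodMk
    (LinearMap.toContinuousLinearMap (R Λ)).contDiff)).add contDiff_const

/-- If the tangent spaces are the kernels of `D y`, with normal vectors `R Λ y`, and the Gram operator
is the identity at `Y`, then there is a Lagrange multiplier `Λ` at `Y`, and the Riemannian Hessian is the
compression to the tangent space of the Hessian of the Lagrangian. -/
theorem exists_multiplier_of_gramOperator_eq_one [CompleteSpace E] {h : E → F} {g : E → ℝ}
    (G : E →ₗ[ℝ] E) (hG : ∀ y, gradient g y = G y)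
    (D : E →ₗ[ℝ] E →ₗ[ℝ] N) (R : N →ₗ[ℝ] E →ₗ[ℝ] E) (P : N →ₗ[ℝ] N)
    (hD : ∀ y v, v ∈ tangentSpaceAt h y ↔ D y v = 0)
    (hR : ∀ y v Λ, D y v = 0 → inner ℝ v (R Λ y) = 0)
    (hP : ∀ Λ, P (P Λ) = P Λ) (hPD : ∀ y v, P (D y v) = D y v)
    {Y : E} (hY : gramOperator D R P Y = 1) :
    ∃ Λ : N, riemannianGrad h g Y = G Y - R Λ Y ∧
      ∀ v ∈ tangentSpaceAt h Y, inner ℝ v (riemannianHess h g Y v) = inner ℝ v (G v - R Λ v) := by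
  have : CompleteSpace N := FiniteDimensional.complete ℝ N
  have hCD : ContDiff ℝ 1 (gramOperator D R P) := contDiff_gramOperator D R P
  have hunit : ∀ᶠ y in nhds Y, IsUnit (gramOperator D R P y) :=
    hCD.continuous.continuousAt.eventually (Units.isOpen.mem_nhds (by
      change IsUnit _
      rw [hY]
      exact isUnit_one))
  let M : E → N := fun y => Ring.inverse (gramOperator D R P y) (D y (G y))
  have hM : DifferentiableAt ℝ M Y := by
    have h1 : DifferentiableAt ℝ (fun y => Ring.inverse (gramOperator D R P y)) Y :=
      DifferentiableAt.comp (g := Ring.inverse) Y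
        (differentiableAt_inverse (by rw [hY]; exact isUnit_one))
        (hCD.differentiable one_ne_zero Y)
    have h2 : ContDiff ℝ 1 fun y => D y (G y) :=
      D.toContinuousBilinearMap.isBoundedBilinearMap.contDiff.comp (contDiff_id.prodMk
        (LinearMap.toContinuousLinearMap G).contDiff)
    exact h1.clm_apply (h2.differentiable one_ne_zero Y)
  -- The formula holds on a whole neighbourhood in the ambient space, including points off the level
  -- set, as the ambient `fderiv` in `riemannianHess` requires.
  have heq : riemannianGrad h g =ᶠ[nhds Y] fun y => G y - R (M y) y := by
    filter_upwards [hunit] with y hy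
    have h1 : gramOperator D R P y (M y) = D y (G y) := by
      change (gramOperator D R P y * Ring.inverse (gramOperator D R P y)) (D y (G y)) = _
      rw [Ring.mul_inverse_cancel _ hy]
      rfl
    -- Applying P removes the completing term Λ - PΛ.
    have h2 := congrArg P h1
    rw [gramOperator_apply, map_add, map_sub, hP, sub_self, add_zero, hPD, hPD] at h2
    rw [riemannianGrad, hG]
    refine Submodule.eq_starProjection_of_mem_of_inner_eq_zero ?_ ?_
    · rw [hD, map_sub, h2, sub_self]
    · intro v hv
      rw [sub_sub_cancel, real_inner_comm]
      exact hR y v _ ((hD y v).1 hv)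
  refine ⟨M Y, heq.eq_of_nhds, fun v hv => ?_⟩
  have hder : HasFDerivAt (fun y => G y - R (M y) y) _ Y :=
    ((LinearMap.toContinuousLinearMap G).hasFDerivAt (x := Y)).sub
      (R.toContinuousBilinearMap.hasFDerivAt_of_bilinear hM.hasFDerivAt (hasFDerivAt_id Y))
  have hfd : fderiv ℝ (riemannianGrad h g) Y v = G v - (R (M Y) v + R (fderiv ℝ M Y v) Y) := by
    rw [heq.fderiv_eq, hder.fderiv]
    rfl
  -- The derivative of the multiplier contributes only a normal vector at `Y`, orthogonal to v; no
  -- formula for that derivative is needed.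
  rw [riemannianHess, ← Submodule.inner_starProjection_left_eq_right,
    Submodule.starProjection_eq_self_iff.2 hv, hfd, ← sub_sub, inner_sub_right,
    hR Y v _ ((hD Y v).1 hv), sub_zero]

end LevelSetCalculus

/-! ### Second-order critical points of the factorized problem -/

section CriticalPoints

variable {n p : ℕ} {V : Type*} [NormedAddCommGroup V] [NormedSpace ℝ V]

theorem mem_tangentSpaceAt_bmConstraint (𝒜 : Matrix (Fin n) (Fin n) ℝ →ₗ[ℝ] V)
    (y v : Matrix (Fin n) (Fin p) ℝ) :
    v ∈ tangentSpaceAt (bmConstraint p 𝒜) y ↔ 𝒜 (y * vᵀ) + 𝒜 (v * yᵀ) = 0 :=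
  mem_tangentSpaceAt_of_quadratic (LinearMap.mk₂ ℝ (fun y v => 𝒜 (y * vᵀ))
    (fun _ _ _ => by rw [Matrix.add_mul, map_add])
    (fun _ _ _ => by rw [Matrix.smul_mul, map_smul])
    (fun _ _ _ => by rw [Matrix.transpose_add, Matrix.mul_add, map_add])
    (fun _ _ _ => by rw [Matrix.transpose_smul, Matrix.mul_smul, map_smul])) (fun _ => rfl) y v

theorem gradient_bmCost {C : Matrix (Fin n) (Fin n) ℝ} (hC : C.IsSymm)
    (y : Matrix (Fin n) (Fin p) ℝ) : gradient (bmCost p C) y = (2 : ℝ) • (C * y) :=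
  gradient_inner_self (g := bmCost p C)
    { toFun := fun y => C * y
      map_add' := fun _ _ => Matrix.mul_add _ _ _
      map_smul' := fun _ _ => Matrix.mul_smul _ _ _ }
    (fun x y => by
      change inner ℝ (C * x) y = inner ℝ x (C * y)
      rw [matrix_inner_mul_right, hC]) (fun _ => rfl) y

variable {d : ℕ}

theorem mem_tangentSpaceAt_blockDiagPart (y v : Matrix (Fin n) (Fin p) ℝ) :
    v ∈ tangentSpaceAt (bmConstraint p (blockDiagPart n d)) y ↔ symBlock n d (v * yᵀ) = 0 := by
  rw [mem_tangentSpaceAt_bmConstraint, symBlock_eq, Matrix.transpose_mul, Matrix.transpose_transpose,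
    map_add,
    smul_eq_zero_iff_right (by norm_num), add_comm]

theorem inner_symBlock_mul_of_mem_tangentSpaceAt {y v : Matrix (Fin n) (Fin p) ℝ}
    (hv : v ∈ tangentSpaceAt (bmConstraint p (blockDiagPart n d)) y)
    (M : Matrix (Fin n) (Fin n) ℝ) : inner ℝ v (symBlock n d M * y) = 0 := by
  rw [real_inner_comm, matrix_inner_mul_left, inner_symBlock_left,
    (mem_tangentSpaceAt_blockDiagPart y v).1 hv, inner_zero_right]

/-- An in-block entry of the product of a block-diagonal matrix with X uses only in-block entries of
X, which are those of the identity. Hence the Gram operator is the identity on ℳ. -/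
theorem symBlock_mul_of_blockDiagPart_eq_one {X : Matrix (Fin n) (Fin n) ℝ}
    (hX : blockDiagPart n d X = 1) (Λ : Matrix (Fin n) (Fin n) ℝ) :
    symBlock n d (symBlock n d Λ * X) = symBlock n d Λ := by
  have key : ∀ i j : Fin n, (i : ℕ) / d = (j : ℕ) / d →
      (symBlock n d Λ * X) i j = symBlock n d Λ i j := by
    intro i j hij
    rw [Matrix.mul_apply]
    have : ∀ k, symBlock n d Λ i k * X k j = symBlock n d Λ i k * (1 : Matrix (Fin n) (Fin n) ℝ) k j := by
      intro k
      rw [← hX, blockDiagPart_apply]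
      by_cases h : (i : ℕ) / d = (k : ℕ) / d
      · rw [if_pos (h.symm.trans hij)]
      · rw [symBlock_apply, if_neg h, zero_mul, zero_mul]
    rw [Finset.sum_congr rfl fun k _ => this k, ← Matrix.mul_apply, Matrix.mul_one]
  conv_rhs => rw [← symBlock_symBlock]
  ext i j
  rw [symBlock_apply, symBlock_apply (symBlock n d Λ)]
  split_ifs with h
  · rw [key i j h, key j i h.symm]
  · rfl

/-- The optimality conditions at a second-order critical point, in terms of the slack matrix
`2 C - P(M)` with `P = symBlock n d`. -/
theorem IsSecondOrderCritical.exists_multiplier {C : Matrix (Fin n) (Fin n) ℝ} (hC : C.IsSymm)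
    {Y : Matrix (Fin n) (Fin p) ℝ} (h : IsSecondOrderCritical (blockDiagPart n d) 1 C Y) :
    ∃ M : Matrix (Fin n) (Fin n) ℝ, ((2 : ℝ) • C - symBlock n d M) * Y = 0 ∧
      ∀ v : Matrix (Fin n) (Fin p) ℝ, symBlock n d (v * Yᵀ) = 0 →
        0 ≤ inner ℝ v (((2 : ℝ) • C - symBlock n d M) * v) := by
  obtain ⟨hY, hgrad, hhess⟩ := h
  let G : Matrix (Fin n) (Fin p) ℝ →ₗ[ℝ] Matrix (Fin n) (Fin p) ℝ :=
    { toFun := fun y => (2 : ℝ) • (C * y)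
      map_add' := fun _ _ => by rw [Matrix.mul_add, smul_add]
      map_smul' := fun r _ => by rw [Matrix.mul_smul, smul_comm, RingHom.id_apply] }
  let D : Matrix (Fin n) (Fin p) ℝ →ₗ[ℝ] Matrix (Fin n) (Fin p) ℝ →ₗ[ℝ] Matrix (Fin n) (Fin n) ℝ :=
    LinearMap.mk₂ ℝ (fun y v => symBlock n d (v * yᵀ))
      (fun _ _ _ => by rw [Matrix.transpose_add, Matrix.mul_add, map_add])
      (fun _ _ _ => by rw [Matrix.transpose_smul, Matrix.mul_smul, map_smul])
      (fun _ _ _ => by rw [Matrix.add_mul, map_add])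
      (fun _ _ _ => by rw [Matrix.smul_mul, map_smul])
  let R : Matrix (Fin n) (Fin n) ℝ →ₗ[ℝ] Matrix (Fin n) (Fin p) ℝ →ₗ[ℝ] Matrix (Fin n) (Fin p) ℝ :=
    LinearMap.mk₂ ℝ (fun Λ y => symBlock n d Λ * y)
      (fun _ _ _ => by rw [map_add, Matrix.add_mul])
      (fun _ _ _ => by rw [map_smul, Matrix.smul_mul])
      (fun _ _ _ => Matrix.mul_add _ _ _)
      (fun _ _ _ => Matrix.mul_smul _ _ _)
  obtain ⟨M, hM, hM'⟩ := exists_multiplier_of_gramOperator_eq_one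
    (h := bmConstraint p (blockDiagPart n d)) (g := bmCost p C) G (gradient_bmCost hC) D R
    (symBlock n d) mem_tangentSpaceAt_blockDiagPart
    (fun y v Λ hv => inner_symBlock_mul_of_mem_tangentSpaceAt
      ((mem_tangentSpaceAt_blockDiagPart y v).2 hv) Λ)
    symBlock_symBlock (fun _ _ => symBlock_symBlock _) (Y := Y)
    (ContinuousLinearMap.ext fun Λ => by
      rw [gramOperator_apply]
      change symBlock n d (symBlock n d Λ * Y * Yᵀ) + (Λ - symBlock n d Λ) = Λ
      rw [Matrix.mul_assoc, symBlock_mul_of_blockDiagPart_eq_one hY, add_sub_cancel])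
  refine ⟨M, ?_, fun v hv => ?_⟩
  · rw [Matrix.sub_mul, Matrix.smul_mul, ← hgrad, hM]
    rfl
  · have hv' := (mem_tangentSpaceAt_blockDiagPart Y v).2 hv
    have h1 := hhess v hv'
    rw [hM' v hv'] at h1
    rwa [Matrix.sub_mul, Matrix.smul_mul]

end CriticalPoints

/-! ### Global optimality of second-order critical points -/

section Optimality

variable {n p d : ℕ}

theorem inner_vecMulVec_mul_vecMulVec (S : Matrix (Fin n) (Fin n) ℝ) (u : Fin n → ℝ)
    (z : Fin p → ℝ) :
    inner ℝ (Matrix.vecMulVec u z) (S * Matrix.vecMulVec u z) = (u ⬝ᵥ S *ᵥ u) * (z ⬝ᵥ z) := by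
  rw [Matrix.mul_vecMulVec, matrix_inner_eq_sum, dotProduct, dotProduct, Finset.sum_mul_sum]
  refine Finset.sum_congr rfl fun i _ => Finset.sum_congr rfl fun j _ => ?_
  rw [Matrix.vecMulVec_apply, Matrix.vecMulVec_apply]
  ring

/-- A symmetric `S` with `S Y = 0` that is nonnegative on tangent directions is positive semidefinite
when `p` is large: a direction of negative curvature would give a tangent vector `u zᵀ - Y B`. -/
theorem posSemidef_of_tangent_nonneg {q : ℕ} (hn : n = q * d) (hp : (d + 1) * n < (d + 3) * p)
    {Y : Matrix (Fin n) (Fin p) ℝ} (hY : blockDiagPart n d (Y * Yᵀ) = 1)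
    {S : Matrix (Fin n) (Fin n) ℝ} (hS : S.IsSymm) (hSY : S * Y = 0)
    (hpos : ∀ v : Matrix (Fin n) (Fin p) ℝ, symBlock n d (v * Yᵀ) = 0 → 0 ≤ inner ℝ v (S * v)) :
    S.PosSemidef := by
  have hYS : Yᵀ * S = 0 := by
    rw [← hS, ← Matrix.transpose_mul, hSY, Matrix.transpose_zero]
  refine Matrix.PosSemidef.of_dotProduct_mulVec_nonneg hS fun u => ?_
  rw [star_trivial]
  suffices h : ∃ z : Fin p → ℝ, z ≠ 0 ∧ 0 ≤ (u ⬝ᵥ S *ᵥ u) * (z ⬝ᵥ z) by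
    obtain ⟨z, hz, h⟩ := h
    have hzz : 0 < z ⬝ᵥ z := by simpa using Matrix.dotProduct_star_self_pos_iff.2 hz
    exact nonneg_of_mul_nonneg_left h hzz
  by_cases hinj : ∀ z, Y *ᵥ z = 0 → z = 0
  · obtain ⟨z, hz, B, hB⟩ := exists_symBlock_vecMulVec_eq hn hp hY hinj u
    refine ⟨z, hz, ?_⟩
    have h := hpos (Matrix.vecMulVec u z - Y * B) (by rw [Matrix.sub_mul, map_sub, hB, sub_self])
    rwa [Matrix.mul_sub, ← Matrix.mul_assoc S Y, hSY, Matrix.zero_mul, sub_zero, inner_sub_left,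
      matrix_inner_mul_right Y B, ← Matrix.mul_assoc, hYS, Matrix.zero_mul, inner_zero_right, sub_zero,
      inner_vecMulVec_mul_vecMulVec] at h
  · push Not at hinj
    obtain ⟨z, hYz, hz⟩ := hinj
    refine ⟨z, hz, ?_⟩
    rw [← inner_vecMulVec_mul_vecMulVec]
    refine hpos _ ?_
    rw [Matrix.vecMulVec_mul, Matrix.vecMul_transpose, hYz, Matrix.vecMulVec_zero, map_zero]

/-- By the Schur product theorem the Hadamard product is positive semidefinite; ⟨S, X⟩ is its
quadratic form at the all-ones vector. -/
theorem inner_nonneg_of_posSemidef {S X : Matrix (Fin n) (Fin n) ℝ} (hS : S.PosSemidef)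
    (hX : X.PosSemidef) : 0 ≤ inner ℝ S X := by
  have h := (hS.hadamard hX).dotProduct_mulVec_nonneg 1
  rw [matrix_inner_eq_sum]
  simpa [Matrix.mulVec, dotProduct] using h

theorem isBMOptimal_of_isSDPOptimal {V : Type*} [NormedAddCommGroup V] [NormedSpace ℝ V]
    {𝒜 : Matrix (Fin n) (Fin n) ℝ →ₗ[ℝ] V} {b : V} {C : Matrix (Fin n) (Fin n) ℝ}
    {Y : Matrix (Fin n) (Fin p) ℝ} (h : IsSDPOptimal 𝒜 b C (Y * Yᵀ)) : IsBMOptimal 𝒜 b C Y := by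
  refine ⟨h.1.1, fun Z hZ => ?_⟩
  have hZ' : Z * Zᵀ ∈ sdpFeasible 𝒜 b := ⟨hZ, Matrix.posSemidef_self_mul_conjTranspose Z⟩
  have := h.2 hZ'
  simp only [Set.mem_ofPred_eq, bmCost] at this ⊢
  rwa [matrix_inner_mul_left, matrix_inner_mul_left]

/-- Weak duality, with complementary slackness ⟨S, YYᵀ⟩ = ⟨SY, Y⟩ = 0. -/
theorem isSDPOptimal_of_posSemidef {C M : Matrix (Fin n) (Fin n) ℝ}
    {Y : Matrix (Fin n) (Fin p) ℝ} (hY : blockDiagPart n d (Y * Yᵀ) = 1)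
    (hSY : ((2 : ℝ) • C - symBlock n d M) * Y = 0)
    (hS : ((2 : ℝ) • C - symBlock n d M).PosSemidef) :
    IsSDPOptimal (blockDiagPart n d) 1 C (Y * Yᵀ) := by
  have hYf : Y * Yᵀ ∈ sdpFeasible (blockDiagPart n d) 1 :=
    ⟨hY, Matrix.posSemidef_self_mul_conjTranspose Y⟩
  have hM : ∀ X ∈ sdpFeasible (blockDiagPart n d) 1, inner ℝ (symBlock n d M) X = inner ℝ M 1 := by
    rintro X ⟨hX, hX'⟩
    have hXt : Xᵀ = X := hX'.isHermitian
    rw [inner_symBlock_left, symBlock_eq, hXt, map_add, hX, ← two_smul ℝ, smul_smul]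
    norm_num
  have hC : ∀ X ∈ sdpFeasible (blockDiagPart n d) 1,
      2 * inner ℝ C X = inner ℝ ((2 : ℝ) • C - symBlock n d M) X + inner ℝ M 1 := by
    intro X hX
    rw [inner_sub_left, hM X hX, real_inner_smul_left]
    ring
  refine ⟨hYf, fun X hX => ?_⟩
  have h1 := hC _ hYf
  have h2 := hC X hX
  have h3 := inner_nonneg_of_posSemidef hS hX.2
  have h4 : inner ℝ ((2 : ℝ) • C - symBlock n d M) (Y * Yᵀ) = 0 := by
    have := matrix_inner_mul_left ((2 : ℝ) • C - symBlock n d M) Y Y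
    rwa [hSY, inner_zero_left, eq_comm] at this
  change inner ℝ C (Y * Yᵀ) ≤ inner ℝ C X
  linarith

theorem IsSecondOrderCritical.optimal {q : ℕ} (hn : n = q * d) (hp : (d + 1) * n < (d + 3) * p)
    {C : Matrix (Fin n) (Fin n) ℝ} (hC : C.IsSymm) {Y : Matrix (Fin n) (Fin p) ℝ}
    (h : IsSecondOrderCritical (blockDiagPart n d) 1 C Y) :
    IsBMOptimal (blockDiagPart n d) 1 C Y ∧ IsSDPOptimal (blockDiagPart n d) 1 C (Y * Yᵀ) := by
  obtain ⟨M, hSY, hpos⟩ := h.exists_multiplier hC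
  have hS : ((2 : ℝ) • C - symBlock n d M).IsSymm := by
    rw [Matrix.IsSymm, Matrix.transpose_sub, Matrix.transpose_smul, hC, symBlock_transpose]
  have hopt := isSDPOptimal_of_posSemidef h.1 hSY
    (posSemidef_of_tangent_nonneg hn hp h.1 hS hSY hpos)
  exact ⟨isBMOptimal_of_isSDPOptimal hopt, hopt⟩

end Optimality

/-! ### Changing the form of the constraints -/

section Transfer

variable {n p : ℕ} {V V' : Type*} [NormedAddCommGroup V] [NormedSpace ℝ V]
  [NormedAddCommGroup V'] [NormedSpace ℝ V']

theorem riemannianGrad_congr {E F F' : Type*} [NormedAddCommGroup E] [InnerProductSpace ℝ E]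
    [FiniteDimensional ℝ E] [CompleteSpace E] [NormedAddCommGroup F] [NormedSpace ℝ F]
    [NormedAddCommGroup F'] [NormedSpace ℝ F'] {h : E → F} {h' : E → F'}
    (hT : ∀ y, tangentSpaceAt h y = tangentSpaceAt h' y) (g : E → ℝ) :
    riemannianGrad h g = riemannianGrad h' g := by
  funext y
  simp only [riemannianGrad, hT]

/-- The constraint map enters the Riemannian gradient and Hessian only through its tangent spaces,
and these depend only on its kernel. This carries the case d = 1 over to the `diag` constraint,
whose values lie in a different space. -/
theorem IsSecondOrderCritical.congr {𝒜 : Matrix (Fin n) (Fin n) ℝ →ₗ[ℝ] V} {b : V}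
    {ℬ : Matrix (Fin n) (Fin n) ℝ →ₗ[ℝ] V'} {b' : V'} (hb : ∀ X, 𝒜 X = b ↔ ℬ X = b')
    (h0 : ∀ X, 𝒜 X = 0 ↔ ℬ X = 0) {C : Matrix (Fin n) (Fin n) ℝ} {Y : Matrix (Fin n) (Fin p) ℝ}
    (h : IsSecondOrderCritical 𝒜 b C Y) : IsSecondOrderCritical ℬ b' C Y := by
  have hT : ∀ y, tangentSpaceAt (bmConstraint p 𝒜) y = tangentSpaceAt (bmConstraint p ℬ) y := by
    intro y
    ext v
    rw [mem_tangentSpaceAt_bmConstraint, mem_tangentSpaceAt_bmConstraint, ← map_add, ← map_add, h0]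
  obtain ⟨h1, h2, h3⟩ := h
  refine ⟨(hb _).1 h1, riemannianGrad_congr hT (bmCost p C) ▸ h2, fun v hv => ?_⟩
  have := h3 v (hT Y ▸ hv)
  simp only [riemannianHess, riemannianGrad_congr hT (bmCost p C), hT] at this
  exact this

theorem IsSDPOptimal.congr {𝒜 : Matrix (Fin n) (Fin n) ℝ →ₗ[ℝ] V} {b : V}
    {ℬ : Matrix (Fin n) (Fin n) ℝ →ₗ[ℝ] V'} {b' : V'} (hb : ∀ X, 𝒜 X = b ↔ ℬ X = b')
    {C X : Matrix (Fin n) (Fin n) ℝ} (h : IsSDPOptimal 𝒜 b C X) : IsSDPOptimal ℬ b' C X := by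
  have hf : sdpFeasible 𝒜 b = sdpFeasible ℬ b' := by
    ext X
    simp only [sdpFeasible, Set.mem_ofPred_eq, hb]
  rw [IsSDPOptimal, ← hf]
  exact h

theorem diag_eq_diag_iff_blockDiagPart_eq (X D : Matrix (Fin n) (Fin n) ℝ)
    (hD : ∀ i j, i ≠ j → D i j = 0) :
    Matrix.diagLinearMap (Fin n) ℝ ℝ X = D.diag ↔ blockDiagPart n 1 X = D := by
  constructor
  · intro h
    ext i j
    rw [blockDiagPart_apply, Nat.div_one, Nat.div_one]
    split_ifs with hij
    · obtain rfl := Fin.ext hij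
      exact congrFun h i
    · exact (hD i j fun h => hij (congrArg Fin.val h)).symm
  · rintro rfl
    funext i
    change X i i = blockDiagPart n 1 X i i
    rw [blockDiagPart_apply, if_pos rfl]

end Transfer

theorem mainTheorem5 :
    -- Orthogonal-Cut: constraint `blockDiagPart n d X = I`, with `n = q d`
    (∀ n q d p : ℕ, n = q * d → ((d : ℝ) + 1) / ((d : ℝ) + 3) * (n : ℝ) < (p : ℝ) →
      ∀ C : Matrix (Fin n) (Fin n) ℝ, C.IsSymm →
      ∀ Y : Matrix (Fin n) (Fin p) ℝ,
        IsSecondOrderCritical (blockDiagPart n d) 1 C Y →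
        IsBMOptimal (blockDiagPart n d) 1 C Y ∧
        IsSDPOptimal (blockDiagPart n d) 1 C (Y * Y.transpose)) ∧
    -- Max-Cut: constraint `diag X = (1, …, 1)`
    (∀ n p : ℕ, (n : ℝ) / 2 < (p : ℝ) →
      ∀ C : Matrix (Fin n) (Fin n) ℝ, C.IsSymm →
      ∀ Y : Matrix (Fin n) (Fin p) ℝ,
        IsSecondOrderCritical (Matrix.diagLinearMap (Fin n) ℝ ℝ) 1 C Y →
        IsBMOptimal (Matrix.diagLinearMap (Fin n) ℝ ℝ) 1 C Y ∧
        IsSDPOptimal (Matrix.diagLinearMap (Fin n) ℝ ℝ) 1 C (Y * Y.transpose)) := by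
  refine ⟨fun n q d p hn hp C hC Y hY => hY.optimal hn ?_ hC, fun n p hp C hC Y hY => ?_⟩
  · rw [div_mul_eq_mul_div, div_lt_iff₀ (by positivity)] at hp
    rw [mul_comm (d + 3)]
    exact_mod_cast hp
  · have h1 : ∀ X, Matrix.diagLinearMap (Fin n) ℝ ℝ X = 1 ↔ blockDiagPart n 1 X = 1 := fun X => by
      rw [← diag_eq_diag_iff_blockDiagPart_eq X 1 fun i j h => Matrix.one_apply_ne h, Matrix.diag_one]
    have h0 : ∀ X, Matrix.diagLinearMap (Fin n) ℝ ℝ X = 0 ↔ blockDiagPart n 1 X = 0 := fun X => by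
      rw [← diag_eq_diag_iff_blockDiagPart_eq X 0 fun i j _ => rfl, Matrix.diag_zero]
    have hp' : (1 + 1) * n < (1 + 3) * p := by
      rw [div_lt_iff₀ (by norm_num)] at hp
      have : n < p * 2 := by exact_mod_cast hp
      lia
    have hopt := ((hY.congr h1 h0).optimal (q := n) (mul_one n).symm hp' hC).2.congr
      fun X => (h1 X).symm
    exact ⟨isBMOptimal_of_isSDPOptimal hopt, hopt⟩
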